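/- Let $S=\mathbb{C}[x_0,\ldots,x_n]$ with $n\ge 0$. For a form (homogeneous polynomial) $F\in S$ of degree $d$, the Waring rank $\mathrm{rk}_{\mathbb C}F$ is the least integer $r$ such that $F=\sum_{j=1}^r\lambda_jL_j^{d}$ for some linear forms $L_1,\ldots,L_r\in S$ and some $\lambda_1,\ldots,\lambda_r\in\mathbb C$. Let $M_1=x_0^{c}x_1^{a_1}\cdots x_n^{a_n}$ and $M_2=x_0^{c}x_1^{b_1}\cdots x_n^{b_n}$ be monomials of the same degree, where $1\le c\le a_i$ and $1\le c\le b_i$ for $i=1,\ldots,n$. Suppose that for every $i=1,\ldots,n$ one has $|a_i-b_i|\in\{0,1\}$ or $|a_i-b_i|\ge c+1$. Let $M_{12}=\gcd(M_1,M_2)$. Then $$\mathrm{rk}_{\mathbb C}(M_1+M_2)\le \mathrm{rk}_{\mathbb C}M_1+\mathrm{rk}_{\mathbb C}M_2-\mathrm{rk}_{\mathbb C}M_{12}.$$ -/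

import Mathlib

open MvPolynomial

/-- `F` is a linear combination of the `d`-th powers of `r` linear forms, where `d = deg F`. -/
def HasWaringDecomposition {m : ℕ} (F : MvPolynomial (Fin m) ℂ) (r : ℕ) : Prop :=
  ∃ (lam : Fin r → ℂ) (L : Fin r → MvPolynomial (Fin m) ℂ),
    (∀ j, (L j).IsHomogeneous 1) ∧ F = ∑ j, C (lam j) * L j ^ F.totalDegree

/-- The complex Waring rank: the least number of linear forms in a Waring decomposition of `F`.
By `hasWaringDecomposition_of_isHomogeneous` the minimum is attained for every form `F`. -/
noncomputable def waringRank {m : ℕ} (F : MvPolynomial (Fin m) ℂ) : ℕ :=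
  sInf {r : ℕ | HasWaringDecomposition F r}

/-- The span of the `d`-th powers of the linear forms. -/
noncomputable def powerSpan (m d : ℕ) : Submodule ℂ (MvPolynomial (Fin m) ℂ) :=
  Submodule.span ℂ {P | ∃ L : MvPolynomial (Fin m) ℂ, L.IsHomogeneous 1 ∧ P = L ^ d}

theorem mul_pow_mem_powerSpan {m : ℕ} (d : ℕ) (L M : MvPolynomial (Fin m) ℂ)
    (hL : L.IsHomogeneous 1) (hM : M.IsHomogeneous 1) :
    L * M ^ d ∈ powerSpan m (d + 1) := by
  by_contra hn
  obtain ⟨f, hf, hker⟩ := Submodule.exists_le_ker_of_notMem hn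
  let p : Polynomial ℂ := ∑ k ∈ Finset.range (d + 1 + 1),
    Polynomial.C (((d + 1).choose k : ℂ) * f (L ^ k * M ^ (d + 1 - k))) * Polynomial.X ^ k
  have hp : p = 0 := by
    apply Polynomial.funext
    intro t
    have h1 : (C t * L + M) ^ (d + 1) ∈ powerSpan m (d + 1) := by
      refine Submodule.subset_span ⟨_, ?_, rfl⟩
      have := ((isHomogeneous_C (Fin m) t).mul hL).add (by simpa using hM)
      simpa using this
    have h2 := hker h1
    rw [LinearMap.mem_ker, add_pow, map_sum] at h2
    simp only [p, Polynomial.eval_finsetSum, Polynomial.eval_mul, Polynomial.eval_C,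
      Polynomial.eval_pow, Polynomial.eval_X, Polynomial.eval_zero]
    rw [← h2]
    refine Finset.sum_congr rfl fun k _ => ?_
    have : (C t * L) ^ k * M ^ (d + 1 - k) * ((d + 1).choose k : MvPolynomial (Fin m) ℂ)
        = (((d + 1).choose k : ℂ) * t ^ k) • (L ^ k * M ^ (d + 1 - k)) := by
      rw [smul_eq_C_mul, map_mul, map_pow, map_natCast]
      ring
    rw [this, map_smul, smul_eq_mul]
    ring
  have hc : p.coeff 1 = ((d + 1).choose 1 : ℂ) * f (L ^ 1 * M ^ (d + 1 - 1)) := by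
    simp only [p, Polynomial.finsetSum_coeff, Polynomial.coeff_C_mul_X_pow]
    rw [Finset.sum_eq_single 1]
    · simp
    · intro b _ hb
      rw [if_neg (Ne.symm hb)]
    · intro h
      simp at h
  rw [hp] at hc
  simp only [Polynomial.coeff_zero, Nat.choose_one_right, pow_one, Nat.add_sub_cancel] at hc
  rcases mul_eq_zero.mp hc.symm with h | h
  · exact (Nat.cast_ne_zero.mpr (Nat.succ_ne_zero d)) h
  · exact hf h

theorem mul_mem_powerSpan {m : ℕ} (d : ℕ) (L P : MvPolynomial (Fin m) ℂ)
    (hL : L.IsHomogeneous 1) (hP : P ∈ powerSpan m d) : L * P ∈ powerSpan m (d + 1) := by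
  induction hP using Submodule.span_induction with
  | mem x hx =>
    obtain ⟨M, hM, rfl⟩ := hx
    exact mul_pow_mem_powerSpan d L M hL hM
  | zero => simp
  | add x y _ _ hx hy => rw [mul_add]; exact Submodule.add_mem _ hx hy
  | smul a x _ hx => rw [mul_smul_comm]; exact Submodule.smul_mem _ a hx

theorem monomial_mem_powerSpan {m : ℕ} (d : ℕ) :
    ∀ e : Fin m →₀ ℕ, e.degree = d → monomial e (1 : ℂ) ∈ powerSpan m d := by
  induction d with
  | zero =>
    intro e he
    rw [Finsupp.degree_eq_zero_iff] at he
    subst he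
    exact Submodule.subset_span ⟨0, isHomogeneous_zero _ _ _, by simp⟩
  | succ d ih =>
    intro e he
    have hne : e ≠ 0 := by
      rintro rfl
      simp at he
    obtain ⟨i, hi⟩ := Finsupp.ne_iff.mp hne
    have hle : Finsupp.single i 1 ≤ e := by
      rw [Finsupp.single_le_iff]
      exact Nat.one_le_iff_ne_zero.mpr hi
    have hdec : Finsupp.single i 1 + (e - Finsupp.single i 1) = e := add_tsub_cancel_of_le hle
    have hdeg : (e - Finsupp.single i 1).degree = d := by
      have := congrArg Finsupp.degree hdec
      rw [map_add, Finsupp.degree_single, he] at this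
      omega
    have := mul_mem_powerSpan d (X i) _ (isHomogeneous_X ℂ i) (ih _ hdeg)
    rwa [X, monomial_mul, hdec, one_mul] at this

/-- Every form over `ℂ` has a Waring decomposition, so the Waring rank is a genuine minimum. -/
theorem hasWaringDecomposition_of_isHomogeneous {m d : ℕ} (F : MvPolynomial (Fin m) ℂ)
    (hF : F.IsHomogeneous d) : ∃ r, HasWaringDecomposition F r := by
  rcases eq_or_ne F 0 with rfl | h0
  · exact ⟨0, Fin.elim0, Fin.elim0, fun j => j.elim0, by simp⟩
  have hd := hF.totalDegree h0
  have hmem : F ∈ powerSpan m d := by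
    rw [F.as_sum]
    refine Submodule.sum_mem _ fun e he => ?_
    have hdeg : e.degree = d := by
      by_contra hne
      exact (mem_support_iff.mp he) (hF.coeff_eq_zero hne)
    have := Submodule.smul_mem (powerSpan m d) (coeff e F) (monomial_mem_powerSpan d e hdeg)
    rwa [smul_monomial, smul_eq_mul, mul_one] at this
  obtain ⟨r, c, g, hg⟩ := Submodule.mem_span_set'.mp hmem
  choose L hL hLd using fun j => (g j).2
  refine ⟨r, c, L, hL, ?_⟩
  rw [hd, ← hg]
  refine Finset.sum_congr rfl fun j _ => ?_
  rw [smul_eq_C_mul, hLd j]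

/-! Both monomials are decomposed over grids of points `(1, p)`, `p ∈ ∏ Zᵢ`, with `|Zᵢ| = aᵢ + 1`. A
grid carries the monomial when the monic polynomial vanishing on each `Zᵢ` has no terms in degrees
`aᵢ - c + 1, …, aᵢ` (`IsGapSet`, `monomial_mem_span_pointPower`). The condition on `|aᵢ - bᵢ|` lets
the sets for `aᵢ` and `bᵢ` be nested (`exists_gapSets`), so the two grids meet in a grid for the
gcd, and their union carries `M₁ + M₂`. Inclusion–exclusion counts the union. The grids of `M₁` and
`M₂` must be no larger than the ranks, which is the lower bound `le_waringRank_monomial`; for the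
gcd only the upper bound is needed. -/

/-! ### Exponents and linear forms -/

/-- The exponent of the monomial `x₀ᶜ x₁^{a₁} ⋯ xₙ^{aₙ}`. -/
noncomputable def consExponent {n : ℕ} (c : ℕ) (a : Fin n → ℕ) : Fin (n + 1) →₀ ℕ :=
  Finsupp.equivFunOnFinite.symm (Fin.cons c a : Fin (n + 1) → ℕ)

@[simp]
theorem consExponent_zero {n : ℕ} (c : ℕ) (a : Fin n → ℕ) : consExponent c a 0 = c := rfl

@[simp]
theorem consExponent_succ {n : ℕ} (c : ℕ) (a : Fin n → ℕ) (i : Fin n) :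
    consExponent c a i.succ = a i := rfl

theorem degree_consExponent {n : ℕ} (c : ℕ) (a : Fin n → ℕ) :
    (consExponent c a).degree = c + ∑ i, a i := by
  simp [Finsupp.degree_eq_sum, Fin.sum_univ_succ]

theorem monomial_consExponent {n : ℕ} (c : ℕ) (a : Fin n → ℕ) :
    monomial (consExponent c a) (1 : ℂ) = X 0 ^ c * ∏ i : Fin n, X i.succ ^ a i := by
  rw [monomial_eq, Finsupp.prod_fintype _ _ (fun i => pow_zero _), Fin.prod_univ_succ]
  simp

/-- The linear form with a given vector of coefficients. -/
noncomputable def linearForm {m : ℕ} (l : Fin m → ℂ) : MvPolynomial (Fin m) ℂ :=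
  ∑ i, l i • X i

theorem isHomogeneous_linearForm {m : ℕ} (l : Fin m → ℂ) : (linearForm l).IsHomogeneous 1 := by
  refine IsHomogeneous.sum _ _ _ fun i _ => ?_
  rw [smul_eq_C_mul]
  exact isHomogeneous_C_mul_X _ _

theorem eq_linearForm {m : ℕ} {L : MvPolynomial (Fin m) ℂ} (hL : L.IsHomogeneous 1) :
    ∃ l, L = linearForm l := by
  have h := hL
  rw [← mem_homogeneousSubmodule, homogeneousSubmodule_one_eq_span_X] at h
  obtain ⟨l, hl⟩ := (Submodule.mem_span_range_iff_exists_fun ℂ).mp h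
  exact ⟨l, hl.symm⟩

theorem coeff_linearForm_pow {m : ℕ} (l : Fin m → ℂ) (e : Fin m →₀ ℕ) (d : ℕ) :
    coeff e (linearForm l ^ d) =
      if e.degree = d then (e.multinomial : ℂ) * ∏ i, l i ^ e i else 0 := by
  rw [linearForm, coeff_linearCombination_X_pow_of_fintype,
    Finsupp.prod_fintype _ _ (fun i => pow_zero _)]
  rfl

theorem cast_multinomial_ne_zero {m : ℕ} (e : Fin m →₀ ℕ) : (e.multinomial : ℂ) ≠ 0 := by
  rw [Finsupp.multinomial_eq]
  exact_mod_cast (Nat.multinomial_pos _ _).ne'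

/-! ### The lower bound for the rank of a monomial -/

/-- If `∑ⱼ λⱼ Lⱼᵈ` is a monomial of exponent `α` with `α₀ ≥ 1`, then the monomials dividing its
dehomogenization are linearly independent on the points `Lⱼ` off the hyperplane `x₀ = 0`. -/
theorem prod_le_of_moments {n r c : ℕ} (hc : 1 ≤ c) (a : Fin n → ℕ) (lam : Fin r → ℂ)
    (l : Fin r → Fin (n + 1) → ℂ) {K : ℂ} (hK : K ≠ 0)
    (h : ∀ e : Fin (n + 1) →₀ ℕ, e.degree = (consExponent c a).degree →
      ∑ j, lam j * ∏ i, l j i ^ e i = if e = consExponent c a then K else 0) :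
    ∏ i, (a i + 1) ≤ r := by
  let v : (∀ i, Fin (a i + 1)) → Fin r → ℂ := fun β j =>
    if l j 0 = 0 then 0 else ∏ i, (l j i.succ / l j 0) ^ (β i : ℕ)
  suffices hv : LinearIndependent ℂ v by
    simpa using hv.fintype_card_le_finrank
  rw [Fintype.linearIndependent_iff]
  intro g hg
  by_contra! hne
  let s : (∀ i, Fin (a i + 1)) → ℕ := fun β => ∑ i, (β i : ℕ)
  -- A term of top degree in the relation is isolated by multiplying with its complement in `a`.
  obtain ⟨β₀, hβ₀, hmax⟩ := Finset.exists_max_image (Finset.univ.filter fun β => g β ≠ 0) s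
    (by obtain ⟨β, hβ⟩ := hne; exact ⟨β, by simpa using hβ⟩)
  simp only [Finset.mem_filter, Finset.mem_univ, true_and] at hβ₀ hmax
  -- Homogenized exponent of `x^(a - β₀) · x^β`. When `g β ≠ 0`, maximality makes the subtraction
  -- exact and the power of `x₀` at least `c ≥ 1`, so points with `x₀ = 0` contribute nothing.
  let e : (∀ i, Fin (a i + 1)) → (Fin (n + 1) →₀ ℕ) := fun β =>
    consExponent (c + s β₀ - s β) fun i => a i - β₀ i + β i
  have hle : ∀ (β : ∀ i, Fin (a i + 1)) i, (β i : ℕ) ≤ a i := fun β i => Nat.lt_succ_iff.mp (β i).2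
  have hsum : ∑ i, (a i - β₀ i) + s β₀ = ∑ i, a i := by
    rw [← Finset.sum_add_distrib]
    exact Finset.sum_congr rfl fun i _ => Nat.sub_add_cancel (hle β₀ i)
  have hdeg : ∀ β, g β ≠ 0 → (e β).degree = (consExponent c a).degree := by
    intro β hβ
    have := hmax β hβ
    simp only [e, degree_consExponent, Finset.sum_add_distrib]
    change _ + (_ + s β) = _
    omega
  have hterm : ∀ β, g β ≠ 0 → ∀ j, ∏ i, l j i ^ e β i =
      l j 0 ^ (c + ∑ i, a i) * (∏ i, (l j i.succ / l j 0) ^ (a i - β₀ i)) * v β j := by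
    intro β hβ j
    have h1 := hmax β hβ
    rw [Fin.prod_univ_succ]
    simp only [e, consExponent_zero, consExponent_succ, v]
    split_ifs with h0
    · rw [h0, zero_pow (by omega)]
      simp
    · rw [mul_assoc, ← Finset.prod_mul_distrib]
      simp_rw [← pow_add, div_pow]
      rw [Finset.prod_div_distrib, Finset.prod_pow_eq_pow_sum, Finset.sum_add_distrib]
      change _ = _ * (_ / l j 0 ^ (_ + s β))
      rw [show c + ∑ i, a i = (c + s β₀ - s β) + (∑ i, (a i - β₀ i) + s β) by omega, pow_add]
      field_simp
  have hzero : ∑ β, g β * ∑ j, lam j * ∏ i, l j i ^ e β i = 0 := by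
    have h1 : ∀ β, g β * ∑ j, lam j * ∏ i, l j i ^ e β i = ∑ j, lam j *
        (l j 0 ^ (c + ∑ i, a i) * ∏ i, (l j i.succ / l j 0) ^ (a i - β₀ i)) * (g β * v β j) := by
      intro β
      rcases eq_or_ne (g β) 0 with hβ | hβ
      · simp [hβ]
      · rw [Finset.mul_sum]
        refine Finset.sum_congr rfl fun j _ => ?_
        rw [hterm β hβ j]
        ring
    rw [Finset.sum_congr rfl fun β _ => h1 β, Finset.sum_comm]
    refine Finset.sum_eq_zero fun j _ => ?_
    rw [← Finset.mul_sum]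
    have := congrFun hg j
    simp only [Finset.sum_apply, Pi.smul_apply, smul_eq_mul, Pi.zero_apply] at this
    rw [this, mul_zero]
  rw [Finset.sum_eq_single β₀] at hzero
  · have he : e β₀ = consExponent c a := by
      simp only [e, Nat.add_sub_cancel]
      congr 1
      funext i
      exact Nat.sub_add_cancel (hle β₀ i)
    rw [h _ (hdeg β₀ hβ₀), if_pos he] at hzero
    exact mul_ne_zero hβ₀ hK hzero
  · intro β _ hβ
    by_cases hgβ : g β = 0
    · simp [hgβ]
    rw [h _ (hdeg β hgβ), if_neg, mul_zero]
    intro he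
    apply hβ
    funext i
    have h1 := DFunLike.congr_fun he i.succ
    simp only [e, consExponent_succ] at h1
    have := hle β₀ i
    exact Fin.ext (by omega)
  · simp

theorem le_waringRank_monomial {n c : ℕ} (hc : 1 ≤ c) (a : Fin n → ℕ) :
    ∏ i, (a i + 1) ≤ waringRank (monomial (consExponent c a) (1 : ℂ)) := by
  have hmem : HasWaringDecomposition _ (waringRank (monomial (consExponent c a) (1 : ℂ))) :=
    Nat.sInf_mem (hasWaringDecomposition_of_isHomogeneous _ (isHomogeneous_monomial 1 rfl))
  obtain ⟨lam, L, hL, h⟩ := hmem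
  choose l hl using fun j => eq_linearForm (hL j)
  refine prod_le_of_moments hc a lam l
    (K := ((consExponent c a).multinomial : ℂ)⁻¹)
    (inv_ne_zero (cast_multinomial_ne_zero _)) fun e he => ?_
  rw [totalDegree_monomial _ one_ne_zero] at h
  have h1 := congrArg (coeff e) h
  simp only [hl, coeff_monomial, coeff_sum, coeff_C_mul, coeff_linearForm_pow] at h1
  have h2 : ∀ j, (lam j * if e.degree = (consExponent c a).sum fun _ k => k then
      (e.multinomial : ℂ) * ∏ i, l j i ^ e i else 0) =
      e.multinomial * (lam j * ∏ i, l j i ^ e i) := by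
    intro j
    rw [if_pos (show e.degree = (consExponent c a).sum fun _ k => k from he)]
    ring
  rw [Finset.sum_congr rfl fun j _ => h2 j, ← Finset.mul_sum] at h1
  have hne := cast_multinomial_ne_zero e
  split_ifs with h3
  · subst h3
    rw [if_pos rfl] at h1
    exact eq_inv_of_mul_eq_one_right h1.symm
  · rw [if_neg (Ne.symm h3)] at h1
    exact (mul_eq_zero.mp h1.symm).resolve_left hne

/-! ### Decompositions supported on grids -/

/-- `Z` is a set of `a + 1` numbers on which `z ^ (a + 1)` agrees with a polynomial of degree at
most `a - c`. -/
def IsGapSet (c a : ℕ) (Z : Finset ℂ) : Prop :=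
  Z.card = a + 1 ∧
    ∃ q : Polynomial ℂ, q.natDegree + c ≤ a ∧ ∀ z ∈ Z, z ^ (a + 1) = q.eval z

/-- The weights are those of the divided difference on `Z`, which reads off the coefficient of `z ^
a` in degree at most `a`. For `a < k ≤ a + c`, the gap replaces `z ^ k` by a polynomial of degree
below `a`. -/
theorem IsGapSet.exists_weights {c a : ℕ} {Z : Finset ℂ} (hZ : IsGapSet c a Z) :
    ∃ w : ℂ → ℂ, ∀ k, k ≤ a + c → ∑ z ∈ Z, w z * z ^ k = if k = a then 1 else 0 := by
  obtain ⟨hcard, q, hq, hz⟩ := hZ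
  have key : ∀ P : Polynomial ℂ, P.natDegree ≤ a →
      ∑ z ∈ Z, (∏ y ∈ Z.erase z, (z - y))⁻¹ * P.eval z = P.coeff a := by
    intro P hP
    have h := Lagrange.coeff_eq_sum (s := Z) (v := id) (Function.injective_id.injOn) (P := P)
      (lt_of_le_of_lt Polynomial.degree_le_natDegree (by
        rw [hcard]; exact_mod_cast Nat.lt_succ_of_le hP))
    rw [hcard, Nat.add_sub_cancel] at h
    rw [h]
    refine Finset.sum_congr rfl fun z _ => ?_
    simp only [id]
    rw [div_eq_inv_mul]
  refine ⟨fun z => (∏ y ∈ Z.erase z, (z - y))⁻¹, fun k hk => ?_⟩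
  rcases le_or_gt k a with hka | hka
  · have := key (Polynomial.X ^ k) (by simpa using hka)
    simp only [Polynomial.eval_pow, Polynomial.eval_X, Polynomial.coeff_X_pow] at this
    rw [this]
    simp only [eq_comm]
  · obtain ⟨s, rfl⟩ : ∃ s, k = a + 1 + s := ⟨k - (a + 1), by omega⟩
    have hdeg : (q * Polynomial.X ^ s).natDegree < a := by
      refine lt_of_le_of_lt Polynomial.natDegree_mul_le ?_
      rw [Polynomial.natDegree_X_pow]
      omega
    have := key (q * Polynomial.X ^ s) hdeg.le
    rw [Polynomial.coeff_eq_zero_of_natDegree_lt hdeg] at this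
    rw [if_neg (by omega), ← this]
    refine Finset.sum_congr rfl fun z hzZ => ?_
    simp only [Polynomial.eval_mul, Polynomial.eval_pow, Polynomial.eval_X]
    rw [pow_add, hz z hzZ]

/-- The `d`-th power of the linear form `x₀ + p₁x₁ + ⋯ + pₙxₙ`. -/
noncomputable def pointPower {n : ℕ} (d : ℕ) (p : Fin n → ℂ) : MvPolynomial (Fin (n + 1)) ℂ :=
  linearForm (Fin.cons 1 p : Fin (n + 1) → ℂ) ^ d

theorem monomial_mem_span_pointPower {n c : ℕ} {a : Fin n → ℕ} {Z : Fin n → Finset ℂ}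
    (hZ : ∀ i, IsGapSet c (a i) (Z i)) :
    monomial (consExponent c a) (1 : ℂ) ∈ Submodule.span ℂ
      (pointPower (c + ∑ i, a i) '' (Fintype.piFinset Z : Set (Fin n → ℂ))) := by
  choose w hw using fun i => (hZ i).exists_weights
  rw [Submodule.mem_span_image_finset_iff_exists_fun']
  refine ⟨fun p => ((consExponent c a).multinomial : ℂ)⁻¹ * ∏ i, w i (p i), ?_⟩
  ext e
  simp only [coeff_sum, coeff_smul, pointPower, coeff_linearForm_pow, coeff_monomial, smul_eq_mul,
    Fin.prod_univ_succ, Fin.cons_zero, Fin.cons_succ, one_pow, one_mul]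
  by_cases he : e.degree = c + ∑ i, a i
  · simp only [he, if_true]
    have hgrid : ∑ p ∈ Fintype.piFinset Z, (((consExponent c a).multinomial : ℂ)⁻¹ *
        ∏ i, w i (p i)) * ((e.multinomial : ℂ) * ∏ i, p i ^ e i.succ) =
        ((consExponent c a).multinomial : ℂ)⁻¹ * e.multinomial *
          ∏ i, ∑ z ∈ Z i, w i z * z ^ e i.succ := by
      rw [Finset.prod_univ_sum, Finset.mul_sum]
      refine Finset.sum_congr rfl fun p _ => ?_
      rw [Finset.prod_mul_distrib]
      ring
    rw [hgrid]
    have hdeg : e 0 + ∑ i : Fin n, e i.succ = c + ∑ i, a i := by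
      rw [← he, Finsupp.degree_eq_sum, Fin.sum_univ_succ]
    by_cases heq : consExponent c a = e
    · subst heq
      rw [if_pos rfl, inv_mul_cancel₀ (cast_multinomial_ne_zero _), one_mul]
      refine Finset.prod_eq_one fun i _ => ?_
      rw [hw i _ (by simp), if_pos (by simp)]
    · rw [if_neg heq]
      suffices ∃ i, ∑ z ∈ Z i, w i z * z ^ e i.succ = 0 by
        obtain ⟨i, hi⟩ := this
        rw [Finset.prod_eq_zero (Finset.mem_univ i) hi, mul_zero]
      -- If no exponent drops below `a i`, the total excess is `c - e 0 ≤ c`, so every exponent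
      -- stays in the range `k ≤ a i + c` controlled by the weights.
      by_cases hlt : ∃ i, e i.succ < a i
      · obtain ⟨i, hi⟩ := hlt
        exact ⟨i, by rw [hw i _ (by omega), if_neg hi.ne]⟩
      · push Not at hlt
        have hne : ∃ i : Fin n, e i.succ ≠ a i := by
          by_contra! hall
          apply heq
          ext j
          refine Fin.cases ?_ (fun i => ?_) j
          · simp only [hall] at hdeg
            simpa using (Nat.add_right_cancel hdeg).symm
          · simp [hall]
        obtain ⟨i, hi⟩ := hne
        refine ⟨i, ?_⟩
        rw [hw i, if_neg hi]
        rw [← Finset.add_sum_erase _ _ (Finset.mem_univ i),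
          ← Finset.add_sum_erase _ a (Finset.mem_univ i)] at hdeg
        have := Finset.sum_le_sum fun j (_ : j ∈ Finset.univ.erase i) => hlt j
        omega
  · have hne : consExponent c a ≠ e := by
      rintro rfl
      exact he (degree_consExponent c a)
    simp [he, hne]

theorem waringRank_le_card {n d : ℕ} {F : MvPolynomial (Fin (n + 1)) ℂ} (hd : F.totalDegree = d)
    {T : Finset (Fin n → ℂ)}
    (hF : F ∈ Submodule.span ℂ (pointPower d '' (T : Set (Fin n → ℂ)))) :
    waringRank F ≤ T.card := by
  rw [Submodule.mem_span_image_finset_iff_exists_fun'] at hF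
  obtain ⟨w, hw⟩ := hF
  refine Nat.sInf_le ⟨fun j => w (T.equivFin.symm j),
    fun j => linearForm (Fin.cons 1 (T.equivFin.symm j).1 : Fin (n + 1) → ℂ),
    fun j => isHomogeneous_linearForm _, ?_⟩
  rw [hd]
  conv_lhs => rw [← hw]
  rw [← Finset.sum_coe_sort, ← T.equivFin.symm.sum_comp]
  simp only [pointPower, smul_eq_C_mul]

/-! ### Nested gap sets -/

theorem exists_finset_roots {k : ℕ} (hk : 0 < k) {t : ℂ} (ht : t ≠ 0) :
    ∃ Z : Finset ℂ, Z.card = k ∧ ∀ z, z ∈ Z ↔ z ^ k = t := by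
  have hζ := Complex.isPrimitiveRoot_exp k hk.ne'
  refine ⟨⟨Polynomial.nthRoots k t, hζ.nthRoots_nodup ht⟩, ?_, fun z => ?_⟩
  · classical
    rw [Finset.card_mk, hζ.card_nthRoots, if_pos]
    exact IsAlgClosed.exists_pow_nat_eq t hk
  · rw [Finset.mem_mk, Polynomial.mem_nthRoots hk]

/-- `Z` is the zero set of `z ^ (a + 1) - 1`. For `W`, this polynomial is kept, multiplied by `z`,
or multiplied by `z ^ (b - a) - 2`; in the last case the gap needs `b - a ≥ c + 1` and `a ≥ c`. -/
theorem exists_gapSets_of_le {c a b : ℕ} (hc : 1 ≤ c) (ha : c ≤ a)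
    (h : b = a ∨ b = a + 1 ∨ a + c + 1 ≤ b) :
    ∃ Z W : Finset ℂ, Z ⊆ W ∧ IsGapSet c a Z ∧ IsGapSet c b W := by
  classical
  obtain ⟨Z, hcard, hmem⟩ := exists_finset_roots (Nat.succ_pos a) (one_ne_zero (α := ℂ))
  have hZ : IsGapSet c a Z :=
    ⟨hcard, 1, by simpa using ha, fun z hz => by simpa using (hmem z).mp hz⟩
  rcases h with rfl | rfl | h
  · exact ⟨Z, Z, subset_rfl, hZ, hZ⟩
  · refine ⟨Z, insert 0 Z, Finset.subset_insert _ _, hZ, ?_, Polynomial.X, ?_, fun z hz => ?_⟩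
    · rw [Finset.card_insert_of_notMem, hcard]
      rw [hmem]
      simp
    · rw [Polynomial.natDegree_X]
      omega
    · rcases Finset.mem_insert.mp hz with rfl | hz
      · simp
      · rw [pow_succ, (hmem z).mp hz]
        simp
  · obtain ⟨k, rfl⟩ : ∃ k, b = a + k := ⟨b - a, by omega⟩
    -- The constant 2 keeps these roots off the unit circle, hence disjoint from `Z`.
    obtain ⟨Y, hYcard, hY⟩ := exists_finset_roots (k := k) (by omega) (two_ne_zero (α := ℂ))
    refine ⟨Z, Z ∪ Y, Finset.subset_union_left, hZ, ?_,
      2 * Polynomial.X ^ (a + 1) + Polynomial.X ^ k - 2, ?_, fun z hz => ?_⟩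
    · rw [Finset.card_union_of_disjoint, hcard, hYcard]
      · omega
      · rw [Finset.disjoint_left]
        intro z h1 h2
        have h3 := Complex.norm_eq_one_of_pow_eq_one ((hmem z).mp h1) (Nat.succ_ne_zero a)
        have h4 := congrArg norm ((hY z).mp h2)
        rw [norm_pow, h3, one_pow] at h4
        norm_num at h4
    · have hdeg : (2 * Polynomial.X ^ (a + 1) + Polynomial.X ^ k - 2 : Polynomial ℂ).natDegree
          ≤ max (a + 1) k := by
        have : (2 : Polynomial ℂ) = Polynomial.C 2 := rfl
        rw [this]
        refine (Polynomial.natDegree_sub_C).le.trans ?_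
        refine (Polynomial.natDegree_add_le _ _).trans ?_
        refine max_le_max (Polynomial.natDegree_C_mul_X_pow_le _ _) ?_
        rw [Polynomial.natDegree_X_pow]
      have : max (a + 1) k + c ≤ a + k := by
        rcases max_cases (a + 1) k with h | h <;> omega
      omega
    · have h0 : (z ^ (a + 1) - 1) * (z ^ k - 2) = 0 := by
        rcases Finset.mem_union.mp hz with hz | hz
        · rw [(hmem z).mp hz, sub_self, zero_mul]
        · rw [(hY z).mp hz, sub_self, mul_zero]
      simp only [Polynomial.eval_sub, Polynomial.eval_add, Polynomial.eval_mul,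
        Polynomial.eval_pow, Polynomial.eval_X, Polynomial.eval_ofNat]
      linear_combination h0

theorem exists_gapSets {c a b : ℕ} (hc : 1 ≤ c) (ha : c ≤ a) (hb : c ≤ b)
    (hab : |(a : ℤ) - b| = 0 ∨ |(a : ℤ) - b| = 1 ∨ (c : ℤ) + 1 ≤ |(a : ℤ) - b|) :
    ∃ Z W : Finset ℂ, IsGapSet c a Z ∧ IsGapSet c b W ∧ IsGapSet c (min a b) (Z ∩ W) := by
  rcases le_total a b with h | h
  · obtain ⟨Z, W, hZW, hZ, hW⟩ := exists_gapSets_of_le (b := b) hc ha (by rw [abs_sub_comm, abs_of_nonneg (by omega)] at hab; omega)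
    exact ⟨Z, W, hZ, hW, by rwa [min_eq_left h, Finset.inter_eq_left.mpr hZW]⟩
  · obtain ⟨Z, W, hZW, hZ, hW⟩ := exists_gapSets_of_le (b := a) hc hb (by rw [abs_of_nonneg (by omega)] at hab; omega)
    exact ⟨W, Z, hW, hZ, by rwa [min_eq_right h, Finset.inter_eq_right.mpr hZW]⟩

/-! ### Greatest common divisors of monomials -/

/-- Divisibility fixes a gcd only up to a unit, hence the scalar `u`. -/
theorem eq_monomial_inf_of_dvd_iff {σ : Type*} {e f : σ →₀ ℕ} {G : MvPolynomial σ ℂ}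
    (hG : ∀ D : MvPolynomial σ ℂ, D ∣ G ↔ D ∣ monomial e 1 ∧ D ∣ monomial f 1) :
    ∃ u : ℂ, u ≠ 0 ∧ G = monomial (e ⊓ f) u := by
  obtain ⟨h1, h2⟩ := (hG G).mp dvd_rfl
  obtain ⟨m, u, -, hu, rfl⟩ := dvd_monomial_one_iff_exists.mp h1
  refine ⟨u, hu.ne_zero, ?_⟩
  have h3 := (hG (monomial (e ⊓ f) 1)).mpr
    ⟨monomial_one_dvd_monomial_one.mpr inf_le_left, monomial_one_dvd_monomial_one.mpr inf_le_right⟩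
  rw [monomial_dvd_monomial] at h1 h2 h3
  have hm : m = e ⊓ f := le_antisymm
    (le_inf (h1.1.resolve_left one_ne_zero) (h2.1.resolve_left one_ne_zero))
    (h3.1.resolve_left hu.ne_zero)
  rw [hm]

theorem consExponent_inf {n : ℕ} (c : ℕ) (a b : Fin n → ℕ) :
    consExponent c a ⊓ consExponent c b = consExponent c fun i => min (a i) (b i) := by
  ext j
  refine Fin.cases ?_ (fun i => ?_) j <;> simp

theorem mainTheorem11 (n c : ℕ) (a b : Fin n → ℕ)
    (hc : 1 ≤ c) (ha : ∀ i, c ≤ a i) (hb : ∀ i, c ≤ b i)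
    (hab : ∀ i, |(a i : ℤ) - b i| = 0 ∨ |(a i : ℤ) - b i| = 1 ∨ (c : ℤ) + 1 ≤ |(a i : ℤ) - b i|)
    (M₁ M₂ M₁₂ : MvPolynomial (Fin (n + 1)) ℂ)
    (hM₁ : M₁ = X 0 ^ c * ∏ i : Fin n, X i.succ ^ a i)
    (hM₂ : M₂ = X 0 ^ c * ∏ i : Fin n, X i.succ ^ b i)
    (hdeg : M₁.totalDegree = M₂.totalDegree)
    (hgcd : ∀ D : MvPolynomial (Fin (n + 1)) ℂ, D ∣ M₁₂ ↔ D ∣ M₁ ∧ D ∣ M₂) :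
    (waringRank (M₁ + M₂) : ℤ) ≤ waringRank M₁ + waringRank M₂ - waringRank M₁₂ := by
  classical
  rw [← monomial_consExponent] at hM₁ hM₂
  subst hM₁ hM₂
  obtain ⟨u, hu, hM₁₂⟩ := eq_monomial_inf_of_dvd_iff hgcd
  rw [consExponent_inf] at hM₁₂
  subst hM₁₂
  choose Z W hZ hW hZW using fun i => exists_gapSets hc (ha i) (hb i) (hab i)
  rw [totalDegree_monomial _ one_ne_zero, totalDegree_monomial _ one_ne_zero] at hdeg
  change (consExponent c a).degree = (consExponent c b).degree at hdeg
  have hcard : ∀ {e : Fin n → ℕ} {V : Fin n → Finset ℂ}, (∀ i, IsGapSet c (e i) (V i)) →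
      (Fintype.piFinset V).card = ∏ i, (e i + 1) := fun hV => by
    rw [Fintype.card_piFinset]
    exact Finset.prod_congr rfl fun i _ => (hV i).1
  have hsum : waringRank (monomial (consExponent c a) (1 : ℂ) + monomial (consExponent c b) 1) ≤
      (Fintype.piFinset Z ∪ Fintype.piFinset W).card := by
    refine waringRank_le_card (d := c + ∑ i, a i) ?_ (Submodule.add_mem _ ?_ ?_)
    · refine IsHomogeneous.totalDegree ((isHomogeneous_monomial 1 (degree_consExponent c a)).add
        (isHomogeneous_monomial 1 (hdeg.symm.trans (degree_consExponent c a)))) fun h => ?_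
      have h1 := congrArg (coeff (consExponent c a)) h
      rw [coeff_add, coeff_monomial, coeff_monomial, if_pos rfl, coeff_zero] at h1
      split_ifs at h1 <;> norm_num at h1
    · refine Submodule.span_mono (Set.image_mono ?_) (monomial_mem_span_pointPower hZ)
      exact_mod_cast Finset.subset_union_left
    · have h := monomial_mem_span_pointPower hW
      rw [← degree_consExponent, ← hdeg, degree_consExponent] at h
      refine Submodule.span_mono (Set.image_mono ?_) h
      exact_mod_cast Finset.subset_union_right
  have hinter : waringRank (monomial (consExponent c fun i => min (a i) (b i)) u) ≤
      (Fintype.piFinset Z ∩ Fintype.piFinset W).card := by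
    rw [← Fintype.piFinset_inter]
    refine waringRank_le_card (totalDegree_monomial _ hu) ?_
    have h := Submodule.smul_mem _ u (monomial_mem_span_pointPower hZW)
    rw [smul_monomial, smul_eq_mul, mul_one, ← degree_consExponent] at h
    exact h
  have hunion := Finset.card_union_add_card_inter (Fintype.piFinset Z) (Fintype.piFinset W)
  rw [hcard hZ, hcard hW] at hunion
  have h₁ := le_waringRank_monomial hc a
  have h₂ := le_waringRank_monomial hc b
  omega
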